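/- Work over $\mathbb{C}$. Let $a_0,\dots,a_5\in\mathbb{C}$ be distinct, put $f(t)=\prod_{i=0}^5(t-a_i)$, and let $X\subset\mathbb{P}^5$ be the Kummer surface with equations $$\sum_i x_i^2=0,\qquad \sum_i a_ix_i^2=0,\qquad \sum_i a_i^2x_i^2=0 .$$ Let $y=[y_0,\dots,y_5]\in X$ be a point with all $y_i\neq 0$, and let $\xi,\eta,\zeta\in\mathbb{C}$ be such that $$y_i^2f'(a_i)=\xi+\eta a_i+\zeta a_i^2\qquad(i=0,\dots,5).$$ Then the embedded tangent plane $\mathbb{T}_yX$ is parametrized bijectively by homogeneous coordinates $(p,q,r)$ through $$x_i=\frac{(p+qa_i+ra_i^2)\,y_i}{\xi+\eta a_i+\zeta a_i^2}\qquad(i=0,\dots,5).$$ Let $\Gamma(y)\subset\mathbb{T}_yX$ be the conic $q^2-4rp=0$. Let $II_y:T_yX\times T_yX\to N_yX$ be the projective second fundamental form of $X$ at $y$, that is, the bilinear map induced by the differential at $y$ of the Gauss map $x\mapsto\mathbb{T}_xX$ (it exists and is unique), and call two directions $[v],[w]\in\mathbb{P}(T_yX)$ conjugate if $II_y(v,w)=0$.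 Identify a direction in $\mathbb{P}(T_yX)$ with the corresponding line through $y$ in $\mathbb{T}_yX$. Then the directions at $y$ that have a conjugate direction are exactly the tangent lines to $\Gamma(y)$ passing through $y$. More precisely, two directions $d,d'$ (possibly equal) are conjugate if and only if $\{d,d'\}$ is the set of all tangent lines to $\Gamma(y)$ through $y$. -/

import Mathlib

open scoped Topology LinearAlgebra.Projectivization

noncomputable section

namespace KummerConj

/-! ### Subsets of projective space: cones, embedded tangent spaces, second fundamental form -/

/-- The affine cone in `ℂⁿ` over a subset of the projective space `ℙ(ℂⁿ)`. -/
def affineCone {n : ℕ} (X : Set (ℙ ℂ (Fin n → ℂ))) : Set (Fin n → ℂ) :=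
  {x | ∀ h : x ≠ 0, Projectivization.mk ℂ x h ∈ X}

/-- The cone in `ℂⁿ` over the embedded (Zariski) tangent space of `X` at the point `[y]`:
the common kernel of the differentials at `y` of all polynomials vanishing on the cone over `X`. -/
def embeddedTangentSpace {n : ℕ} (X : Set (ℙ ℂ (Fin n → ℂ))) (y : Fin n → ℂ) :
    Submodule ℂ (Fin n → ℂ) where
  carrier := {v | ∀ F : MvPolynomial (Fin n) ℂ,
    (∀ x ∈ affineCone X, MvPolynomial.eval x F = 0) →
      ∑ i, MvPolynomial.eval y (MvPolynomial.pderiv i F) * v i = 0}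
  add_mem' := by
    intro v w hv hw F hF
    simp only [Pi.add_apply, mul_add, Finset.sum_add_distrib, hv F hF, hw F hF, add_zero]
  zero_mem' := by
    intro F _
    simp
  smul_mem' := by
    intro k v hv F hF
    have h := hv F hF
    simp only [Pi.smul_apply, smul_eq_mul, mul_left_comm _ k, ← Finset.mul_sum, h, mul_zero]

/-- The tangent space `T_yX = T̂_yX / ŷ`, where `T̂_yX` is the cone over the embedded tangent space
and `ŷ` is the line spanned by `y`. -/
abbrev TangentSpaceAt {n : ℕ} (X : Set (ℙ ℂ (Fin n → ℂ))) (y : Fin n → ℂ) : Type :=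
  embeddedTangentSpace X y ⧸ (Submodule.span ℂ {y}).submoduleOf (embeddedTangentSpace X y)

/-- The class in `T_yX` of a vector of `T̂_yX`. -/
abbrev toTangent {n : ℕ} (X : Set (ℙ ℂ (Fin n → ℂ))) (y : Fin n → ℂ) :
    embeddedTangentSpace X y →ₗ[ℂ] TangentSpaceAt X y :=
  ((Submodule.span ℂ {y}).submoduleOf (embeddedTangentSpace X y)).mkQ

/-- The normal space `N_yX = V / T̂_yX`. -/
abbrev NormalSpaceAt {n : ℕ} (X : Set (ℙ ℂ (Fin n → ℂ))) (y : Fin n → ℂ) : Type :=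
  (Fin n → ℂ) ⧸ embeddedTangentSpace X y

/-- `s` is (the germ at `0` of) a holomorphic section of the family of subspaces `W`. -/
def IsSection {n : ℕ} (W : ℂ → Submodule ℂ (Fin n → ℂ)) (s : ℂ → Fin n → ℂ) : Prop :=
  AnalyticAt ℂ s 0 ∧ ∀ᶠ t in 𝓝 (0 : ℂ), s t ∈ W t

/-- `D ∈ Hom(U, V/U)` is the tangent vector at `t = 0` of the curve `t ↦ W t` of subspaces of
`V = ℂⁿ` with `W 0 = U`: every `w ∈ U` extends to a holomorphic section `s` of `W`, and
for every such section `D w` is the class of `s'(0)` modulo `U`. This is the usual identification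
of the tangent space of the Grassmannian at `U` with `Hom(U, V/U)`. -/
def IsGrassmannVelocity {n : ℕ} (W : ℂ → Submodule ℂ (Fin n → ℂ))
    (U : Submodule ℂ (Fin n → ℂ)) (D : U →ₗ[ℂ] (Fin n → ℂ) ⧸ U) : Prop :=
  W 0 = U ∧
  (∀ w : U, ∃ s : ℂ → Fin n → ℂ, IsSection W s ∧ s 0 = w) ∧
  ∀ (w : U) (s : ℂ → Fin n → ℂ), IsSection W s → s 0 = w → D w = U.mkQ (deriv s 0)

/-- `c` is (the germ at `0` of) a holomorphic curve on the cone over `X`, through `y` with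
velocity `v`. -/
def IsCurveThrough {n : ℕ} (X : Set (ℙ ℂ (Fin n → ℂ))) (y v : Fin n → ℂ)
    (c : ℂ → Fin n → ℂ) : Prop :=
  AnalyticAt ℂ c 0 ∧ (∀ᶠ t in 𝓝 (0 : ℂ), c t ∈ affineCone X) ∧ c 0 = y ∧ deriv c 0 = v

/-- `II : T_yX × T_yX → N_yX` is the projective second fundamental form of `X` at `[y]`: the
bilinear map induced by the differential at `[y]` of the Gauss map `x ↦ T̂_xX`. That is, every
tangent vector `v` is the velocity of a curve on `X`, and for every curve `c` on `X` through `y`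
with velocity `v`, the velocity of the image curve `t ↦ T̂_{c(t)}X` in the Grassmannian is
`w ↦ II(v, w)`. -/
def IsSecondFundamentalForm {n : ℕ} (X : Set (ℙ ℂ (Fin n → ℂ))) (y : Fin n → ℂ)
    (II : TangentSpaceAt X y →ₗ[ℂ] TangentSpaceAt X y →ₗ[ℂ] NormalSpaceAt X y) : Prop :=
  (∀ v : embeddedTangentSpace X y, ∃ c, IsCurveThrough X y v c) ∧
  ∀ (v : embeddedTangentSpace X y) (c : ℂ → Fin n → ℂ), IsCurveThrough X y v c →
    IsGrassmannVelocity (fun t => embeddedTangentSpace X (c t)) (embeddedTangentSpace X y)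
      ((II (toTangent X y v)).comp (toTangent X y))

/-- The second fundamental form is unique. -/
theorem IsSecondFundamentalForm.unique {n : ℕ} {X : Set (ℙ ℂ (Fin n → ℂ))} {y : Fin n → ℂ}
    {B B' : TangentSpaceAt X y →ₗ[ℂ] TangentSpaceAt X y →ₗ[ℂ] NormalSpaceAt X y}
    (h : IsSecondFundamentalForm X y B) (h' : IsSecondFundamentalForm X y B') : B = B' := by
  ext v w : 4
  obtain ⟨c, hc⟩ := h.1 v
  obtain ⟨-, hs, hB⟩ := h.2 v c hc
  obtain ⟨-, -, hB'⟩ := h'.2 v c hc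
  obtain ⟨s, hs1, hs2⟩ := hs w
  exact (hB w s hs1 hs2).trans (hB' w s hs1 hs2).symm

/-- Two tangent directions `d, d' ∈ ℙ(T_yX)` are conjugate with respect to `II` if
`II(v, w) = 0` for vectors `v, w` representing them. -/
def AreConjugate {n : ℕ} {X : Set (ℙ ℂ (Fin n → ℂ))} {y : Fin n → ℂ}
    (II : TangentSpaceAt X y →ₗ[ℂ] TangentSpaceAt X y →ₗ[ℂ] NormalSpaceAt X y)
    (d d' : ℙ ℂ (TangentSpaceAt X y)) : Prop :=
  II d.rep d'.rep = 0

/-- The line through `[y]` in the embedded tangent space with direction `d ∈ ℙ(T_yX)`, given as a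
linear subspace of `ℂⁿ`. -/
def tangentLine {n : ℕ} (X : Set (ℙ ℂ (Fin n → ℂ))) (y : Fin n → ℂ)
    (d : ℙ ℂ (TangentSpaceAt X y)) : Submodule ℂ (Fin n → ℂ) :=
  (d.submodule.comap (toTangent X y)).map (embeddedTangentSpace X y).subtype

/-- The tangent lines of the curve `C` that pass through the point `[y]`, given as linear subspaces
of `ℂⁿ`: the embedded tangent spaces of `C` at its points that contain `y`. -/
def tangentLinesThrough {n : ℕ} (C : Set (ℙ ℂ (Fin n → ℂ))) (y : Fin n → ℂ) :
    Set (Submodule ℂ (Fin n → ℂ)) :=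
  {L | ∃ u ∈ C, L = embeddedTangentSpace C u.rep ∧ y ∈ L}

/-! ### The Kummer surface -/

/-- The surface in `ℙ⁵` with equations `∑ xᵢ² = ∑ aᵢ xᵢ² = ∑ aᵢ² xᵢ² = 0`. -/
def kummerSurface (a : Fin 6 → ℂ) : Set (ℙ ℂ (Fin 6 → ℂ)) :=
  {x | ∑ i, x.rep i ^ 2 = 0 ∧ ∑ i, a i * x.rep i ^ 2 = 0 ∧ ∑ i, a i ^ 2 * x.rep i ^ 2 = 0}

/-- The polynomial `f(t) = ∏ (t - aᵢ)`. -/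
def nodePolynomial (a : Fin 6 → ℂ) : Polynomial ℂ :=
  ∏ i, (Polynomial.X - Polynomial.C (a i))

/-- The map `(p, q, r) ↦ ((p + q aᵢ + r aᵢ²) yᵢ / (ξ + η aᵢ + ζ aᵢ²))ᵢ`; here `m = (p, q, r)`. -/
def planeParam (a y : Fin 6 → ℂ) (ξ η ζ : ℂ) : (Fin 3 → ℂ) →ₗ[ℂ] (Fin 6 → ℂ) where
  toFun m i := (m 0 + m 1 * a i + m 2 * a i ^ 2) * y i / (ξ + η * a i + ζ * a i ^ 2)
  map_add' m m' := by
    ext i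
    simp only [Pi.add_apply]
    ring
  map_smul' k m := by
    ext i
    simp only [Pi.smul_apply, smul_eq_mul, RingHom.id_apply]
    ring

/-- The conic `Γ(y)` in `ℙ⁵`, of equation `q² - 4rp = 0` in the parametrized plane. -/
def conicGamma (a y : Fin 6 → ℂ) (ξ η ζ : ℂ) : Set (ℙ ℂ (Fin 6 → ℂ)) :=
  {x | ∃ p q r : ℂ, x.rep = planeParam a y ξ η ζ ![p, q, r] ∧ q ^ 2 - 4 * r * p = 0}

end KummerConj

end

noncomputable section

namespace KummerConj

/-! ### Quadratic polynomials and Lagrange interpolation -/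

/-! Everything becomes divisibility of binary quadratic forms. Since the three quadrics are diagonal
and all `y i` are nonzero, `v` is tangent at `y` exactly when `y i * v i` is orthogonal to `1, a,
a²`. Lagrange interpolation at the six nodes (`sum_pow_mul_eq_zero_iff`) says that `u` has this
orthogonality iff `u i * f'(a i)` is the value at `a i` of some form of degree at most two. With `y
i ^ 2 * f'(a i) = g(a i)`, this gives the parametrization `h ↦ h(a i) * y i / g(a i)` of the tangent
plane, in which `y` itself is the image of `g`.

Differentiating the tangency equations along a curve gives `II(v, w) = -(v i * w i / y i)` modulo
the tangent space, so `II(v, w) = 0` iff `v i * w i` is again orthogonal to `1, a, a²`. If `v`, `w`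
come from `h`, `k`, then `v i * w i * f'(a i) = (h k / g)(a i)`. Conjugacy thus says that `h k = l
g` for some `l` at six points, hence identically, both sides being quartic.

Factor `g = α β` over `ℂ`. Directions correspond to forms modulo `g`, so neither `h` nor `k` is a
multiple of `g`, and `g ∣ h k` forces `α ∣ h`, `β ∣ k` or the reverse (`exists_formMulEq_iff`). The
conic `Γ(y)` is the locus of squares `m²`, with tangent line `{m l}` at `m²`; this line contains `y`
iff `m ∣ g`, i.e. iff `m` is proportional to `α` or `β`. The two descriptions agree, including when
`α` and `β` are proportional, which means that `y` lies on `Γ(y)`. -/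

/-- The value at `t` of the quadratic polynomial with coefficients `h`. -/
def quadEval (h : Fin 3 → ℂ) (t : ℂ) : ℂ := h 0 + h 1 * t + h 2 * t ^ 2

theorem nodePolynomial_eq_nodal (a : Fin 6 → ℂ) :
    nodePolynomial a = Lagrange.nodal Finset.univ a := by
  rw [nodePolynomial, Lagrange.nodal_eq]

theorem derivative_nodePolynomial_eval_ne_zero {a : Fin 6 → ℂ} (ha : Function.Injective a)
    (i : Fin 6) : (nodePolynomial a).derivative.eval (a i) ≠ 0 := by
  rw [nodePolynomial_eq_nodal, Lagrange.eval_nodal_derivative_eval_node_eq (Finset.mem_univ i),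
    Lagrange.eval_nodal, Finset.prod_ne_zero_iff]
  intro j hj h
  exact (Finset.mem_erase.mp hj).1 (ha (sub_eq_zero.mp h)).symm

/-- The leading coefficient of each Lagrange basis polynomial is `1 / f'(a i)`. -/
theorem coeff_five_eq_sum {a : Fin 6 → ℂ} (ha : Function.Injective a) {P : Polynomial ℂ}
    (hP : P.degree < 6) :
    P.coeff 5 = ∑ i, P.eval (a i) / (nodePolynomial a).derivative.eval (a i) := by
  have h := Lagrange.coeff_eq_sum (s := Finset.univ) (v := a) ha.injOn (P := P) (by simpa using hP)
  simp only [Finset.card_univ, Fintype.card_fin, Nat.reduceSub] at h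
  rw [h]
  refine Finset.sum_congr rfl fun i _ => ?_
  rw [nodePolynomial_eq_nodal, Lagrange.eval_nodal_derivative_eval_node_eq (Finset.mem_univ i),
    Lagrange.eval_nodal]

theorem degree_lt_of_degree_lt_succ {P : Polynomial ℂ} {n : ℕ} (h : P.degree < ((n + 1 : ℕ) : WithBot ℕ))
    (h0 : P.coeff n = 0) : P.degree < n := by
  rw [Polynomial.degree_lt_iff_coeff_zero] at h ⊢
  intro m hm
  rcases hm.eq_or_lt with rfl | hm
  · exact h0
  · exact h m hm

/-- A vector is orthogonal to `1, a, a²` if and only if it is of the form `h(aᵢ) / f'(aᵢ)` with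
`h` of degree at most two. -/
theorem sum_pow_mul_eq_zero_iff {a : Fin 6 → ℂ} (ha : Function.Injective a) (u : Fin 6 → ℂ) :
    (∀ j : Fin 3, ∑ i, a i ^ (j : ℕ) * u i = 0) ↔
      ∃ h : Fin 3 → ℂ, ∀ i, u i * (nodePolynomial a).derivative.eval (a i) = quadEval h (a i) := by
  have hf := derivative_nodePolynomial_eval_ne_zero ha
  constructor
  · intro hu
    obtain ⟨P, hdeg, hP⟩ : ∃ P : Polynomial ℂ, P.degree < ((6 : ℕ) : WithBot ℕ) ∧
        ∀ i, P.eval (a i) = u i * (nodePolynomial a).derivative.eval (a i) := by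
      refine ⟨Lagrange.interpolate Finset.univ a
        fun i => u i * (nodePolynomial a).derivative.eval (a i), ?_, fun i => ?_⟩
      · simpa using Lagrange.degree_interpolate_lt (s := Finset.univ) (v := a)
          (fun i => u i * (nodePolynomial a).derivative.eval (a i)) ha.injOn
      · exact Lagrange.eval_interpolate_at_node _ ha.injOn (Finset.mem_univ i)
    -- The `j`-th orthogonality relation is the vanishing of the `t⁵`-coefficient of `P * X ^ j`,
    -- that is, of the coefficient of `P` in degree `5 - j`. Each use lowers the degree bound on
    -- `P`, which makes the next multiplication by `X` admissible.
    have key : ∀ j : Fin 3, (P * Polynomial.X ^ (j : ℕ)).degree < ((6 : ℕ) : WithBot ℕ) →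
        (P * Polynomial.X ^ (j : ℕ)).coeff 5 = 0 := by
      intro j hj
      rw [coeff_five_eq_sum ha hj, ← hu j]
      refine Finset.sum_congr rfl fun i _ => ?_
      rw [Polynomial.eval_mul, Polynomial.eval_pow, Polynomial.eval_X, hP]
      field_simp [hf i]
    have h5 : P.degree < ((5 : ℕ) : WithBot ℕ) := by
      refine degree_lt_of_degree_lt_succ hdeg ?_
      simpa using key 0 (by simpa using hdeg)
    have h4 : P.degree < ((4 : ℕ) : WithBot ℕ) := by
      refine degree_lt_of_degree_lt_succ h5 ?_
      have := key 1 (by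
        rw [Polynomial.degree_lt_iff_coeff_zero] at h5 ⊢
        intro m hm
        obtain ⟨k, rfl⟩ := Nat.exists_eq_add_of_le' (show 1 ≤ m by omega)
        simpa using h5 k (by omega))
      simpa [Polynomial.coeff_mul_X_pow'] using this
    have h3 : P.degree < ((3 : ℕ) : WithBot ℕ) := by
      refine degree_lt_of_degree_lt_succ h4 ?_
      have := key 2 (by
        rw [Polynomial.degree_lt_iff_coeff_zero] at h4 ⊢
        intro m hm
        obtain ⟨k, rfl⟩ := Nat.exists_eq_add_of_le' (show 2 ≤ m by omega)
        simpa [Polynomial.coeff_mul_X_pow'] using h4 k (by omega))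
      simpa [Polynomial.coeff_mul_X_pow'] using this
    refine ⟨fun j => P.coeff j, fun i => ?_⟩
    have hn : P.natDegree < 3 := by
      by_cases hP0 : P = 0
      · simp [hP0]
      · exact (Polynomial.natDegree_lt_iff_degree_lt hP0).2 h3
    rw [← hP, Polynomial.eval_eq_sum_range' hn]
    simp [Finset.sum_range_succ, quadEval]
  · rintro ⟨h, hh⟩ j
    let P : Polynomial ℂ := Polynomial.X ^ (j : ℕ) *
      (Polynomial.C (h 0) + Polynomial.C (h 1) * Polynomial.X
        + Polynomial.C (h 2) * Polynomial.X ^ 2)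
    have hdeg : P.degree < ((5 : ℕ) : WithBot ℕ) := by
      have h1 : P.degree ≤ ((j : ℕ) : WithBot ℕ) + ((2 : ℕ) : WithBot ℕ) := by
        refine (Polynomial.degree_mul_le _ _).trans (add_le_add (Polynomial.degree_X_pow_le _) ?_)
        compute_degree
        norm_num
      refine h1.trans_lt ?_
      have := j.2
      exact_mod_cast (by omega : (j : ℕ) + 2 < 5)
    have h5 := coeff_five_eq_sum ha (P := P) (hdeg.trans (by norm_num))
    rw [Polynomial.coeff_eq_zero_of_degree_lt hdeg] at h5
    rw [h5]
    refine Finset.sum_congr rfl fun i _ => ?_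
    have e : P.eval (a i) = a i ^ (j : ℕ) * quadEval h (a i) := by simp [P, quadEval]
    rw [e, ← hh]
    field_simp [hf i]

/-- A nonzero quartic has at most four roots, so the Vandermonde argument on the first five nodes
suffices. -/
theorem eq_zero_of_quartic_eval_eq_zero {a : Fin 6 → ℂ} (ha : Function.Injective a)
    {c : Fin 5 → ℂ} (h : ∀ i, ∑ k, c k * a i ^ (k : ℕ) = 0) : c = 0 := by
  have := Matrix.eq_zero_of_forall_index_sum_mul_pow_eq_zero
    (f := fun i : Fin 5 => a i.castSucc) (v := c) (ha.comp (Fin.castSucc_injective 5))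
    (fun j => h _)
  exact this

theorem quadEval_injective {a : Fin 6 → ℂ} (ha : Function.Injective a) {h k : Fin 3 → ℂ}
    (hk : ∀ i, quadEval h (a i) = quadEval k (a i)) : h = k := by
  have := eq_zero_of_quartic_eval_eq_zero ha (c := ![h 0 - k 0, h 1 - k 1, h 2 - k 2, 0, 0])
    (fun i => by
      have := hk i
      simp only [quadEval] at this
      simp [Fin.sum_univ_succ]
      linear_combination this)
  have e := fun j => congrFun this j
  ext j
  fin_cases j
  · simpa [sub_eq_zero] using e 0
  · simpa [sub_eq_zero] using e 1
  · simpa [sub_eq_zero] using e 2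

/-! ### Binary forms -/

/-- The product of two binary linear forms. -/
def formMul (α β : Fin 2 → ℂ) : Fin 3 → ℂ :=
  ![α 0 * β 0, α 0 * β 1 + α 1 * β 0, α 1 * β 1]

theorem formMul_comm (α β : Fin 2 → ℂ) : formMul α β = formMul β α := by
  ext j; fin_cases j <;> simp [formMul] <;> ring

theorem formMul_zero_left (β : Fin 2 → ℂ) : formMul 0 β = 0 := by
  ext j; fin_cases j <;> simp [formMul]

theorem formMul_smul_right (c : ℂ) (α β : Fin 2 → ℂ) : formMul α (c • β) = c • formMul α β := by
  ext j; fin_cases j <;> simp [formMul] <;> ring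

/-- The value of a binary quadratic form at the zero of the binary linear form `α`. -/
def evalAtZero (α : Fin 2 → ℂ) (h : Fin 3 → ℂ) : ℂ :=
  h 0 * α 1 ^ 2 - h 1 * α 0 * α 1 + h 2 * α 0 ^ 2

theorem ne_zero_or_ne_zero {α : Fin 2 → ℂ} (hα : α ≠ 0) : α 0 ≠ 0 ∨ α 1 ≠ 0 := by
  by_contra! h
  exact hα (by ext j; fin_cases j <;> simp [h.1, h.2])

/-- Factor theorem for binary forms. The zero of `α` is the homogeneous point `[α 1 : -α 0]`, so the
root at infinity (`α 1 = 0`) is included; the division starts from whichever coefficient of `α` is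
nonzero. -/
theorem evalAtZero_eq_zero_iff {α : Fin 2 → ℂ} (hα : α ≠ 0) (h : Fin 3 → ℂ) :
    evalAtZero α h = 0 ↔ ∃ m, h = formMul α m := by
  constructor
  · intro H
    simp only [evalAtZero] at H
    rcases ne_zero_or_ne_zero hα with h0 | h1
    · refine ⟨![h 0 / α 0, (h 1 - α 1 * (h 0 / α 0)) / α 0], ?_⟩
      ext j; fin_cases j <;> simp [formMul] <;> field_simp
      · ring
      · linear_combination H
    · refine ⟨![(h 1 - α 0 * (h 2 / α 1)) / α 1, h 2 / α 1], ?_⟩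
      ext j; fin_cases j <;> simp [formMul] <;> field_simp
      · linear_combination H
      · ring
  · rintro ⟨m, rfl⟩
    simp [evalAtZero, formMul]
    ring

theorem evalAtZero_formMul (α β m : Fin 2 → ℂ) :
    evalAtZero α (formMul β m) =
      (α 1 * β 0 - α 0 * β 1) * (α 1 * m 0 - α 0 * m 1) := by
  simp [evalAtZero, formMul]
  ring

theorem exists_eq_smul_of_det_eq_zero {α β : Fin 2 → ℂ} (hα : α ≠ 0)
    (h : α 1 * β 0 - α 0 * β 1 = 0) : ∃ c : ℂ, β = c • α := by
  rcases ne_zero_or_ne_zero hα with h0 | h1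
  · refine ⟨β 0 / α 0, ?_⟩
    ext j; fin_cases j <;> simp <;> field_simp
    linear_combination -h
  · refine ⟨β 1 / α 1, ?_⟩
    ext j; fin_cases j <;> simp <;> field_simp
    linear_combination h

theorem exists_det_ne_zero {β : Fin 2 → ℂ} (hβ : β ≠ 0) :
    ∃ m : Fin 2 → ℂ, β 1 * m 0 - β 0 * m 1 ≠ 0 := by
  rcases ne_zero_or_ne_zero hβ with h0 | h1
  · exact ⟨![0, 1], by simpa⟩
  · exact ⟨![1, 0], by simpa⟩

theorem exists_eq_formMul (g : Fin 3 → ℂ) : ∃ α β, g = formMul α β := by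
  by_cases h2 : g 2 = 0
  · refine ⟨![1, 0], ![g 0, g 1], ?_⟩
    ext j; fin_cases j <;> simp [formMul, h2]
  -- Quadratic formula, with `s` a square root of the discriminant; the case `g 2 = 0` above is a
  -- root at infinity.
  · obtain ⟨s, hs⟩ := IsAlgClosed.exists_pow_nat_eq (g 1 ^ 2 - 4 * g 0 * g 2) (n := 2) (by norm_num)
    refine ⟨![(g 1 - s) / 2, g 2], ![(g 1 + s) / (2 * g 2), 1], ?_⟩
    ext j; fin_cases j <;> simp [formMul] <;> field_simp
    · linear_combination hs
    · ring

/-- The discriminant of `α β` is the square of the determinant of `α` and `β`. If it vanishes, the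
factors are proportional, and the scalar has a square root in `ℂ`. -/
theorem exists_eq_formMul_self {h : Fin 3 → ℂ} (hh : h 1 ^ 2 - 4 * h 2 * h 0 = 0) :
    ∃ m, h = formMul m m := by
  obtain ⟨α, β, rfl⟩ := exists_eq_formMul h
  by_cases hα : α = 0
  · exact ⟨0, by rw [hα, formMul_zero_left, formMul_zero_left]⟩
  have : (α 1 * β 0 - α 0 * β 1) ^ 2 = 0 := by
    simp [formMul] at hh
    linear_combination hh
  obtain ⟨c, rfl⟩ := exists_eq_smul_of_det_eq_zero hα (pow_eq_zero_iff two_ne_zero |>.1 this)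
  obtain ⟨s, hs⟩ := IsAlgClosed.exists_pow_nat_eq c (n := 2) (by norm_num)
  refine ⟨s • α, ?_⟩
  rw [formMul_smul_right, formMul_smul_right, formMul_comm (s • α), formMul_smul_right, smul_smul,
    ← sq, hs]

/-- `h * k = ℓ * g` for binary quadratic forms. -/
def FormMulEq (h k l g : Fin 3 → ℂ) : Prop :=
  h 0 * k 0 = l 0 * g 0 ∧ h 0 * k 1 + h 1 * k 0 = l 0 * g 1 + l 1 * g 0 ∧
  h 0 * k 2 + h 1 * k 1 + h 2 * k 0 = l 0 * g 2 + l 1 * g 1 + l 2 * g 0 ∧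
  h 1 * k 2 + h 2 * k 1 = l 1 * g 2 + l 2 * g 1 ∧ h 2 * k 2 = l 2 * g 2

theorem formMulEq_iff {a : Fin 6 → ℂ} (ha : Function.Injective a) (h k l g : Fin 3 → ℂ) :
    (∀ i, quadEval h (a i) * quadEval k (a i) = quadEval l (a i) * quadEval g (a i)) ↔
      FormMulEq h k l g := by
  constructor
  · intro H
    have := eq_zero_of_quartic_eval_eq_zero ha (c := ![h 0 * k 0 - l 0 * g 0,
      h 0 * k 1 + h 1 * k 0 - (l 0 * g 1 + l 1 * g 0),
      h 0 * k 2 + h 1 * k 1 + h 2 * k 0 - (l 0 * g 2 + l 1 * g 1 + l 2 * g 0),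
      h 1 * k 2 + h 2 * k 1 - (l 1 * g 2 + l 2 * g 1), h 2 * k 2 - l 2 * g 2])
      (fun i => by
        have := H i
        simp only [quadEval] at this
        simp [Fin.sum_univ_succ]
        linear_combination this)
    have e := fun j => congrFun this j
    exact ⟨sub_eq_zero.1 (e 0), sub_eq_zero.1 (e 1), sub_eq_zero.1 (e 2), sub_eq_zero.1 (e 3),
      sub_eq_zero.1 (e 4)⟩
  · rintro ⟨h0, h1, h2, h3, h4⟩ i
    simp only [quadEval]
    linear_combination h0 + a i * h1 + a i ^ 2 * h2 + a i ^ 3 * h3 + a i ^ 4 * h4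

/-- The identity `h k = l α β` is evaluated at the point `[α 1 : -α 0]`; the multipliers below are
the quartic monomials there. -/
theorem evalAtZero_mul_eq_zero {α β : Fin 2 → ℂ} {h k l : Fin 3 → ℂ}
    (H : FormMulEq h k l (formMul α β)) : evalAtZero α h * evalAtZero α k = 0 := by
  obtain ⟨h0, h1, h2, h3, h4⟩ := H
  simp only [evalAtZero]
  simp [formMul] at h0 h1 h2 h3 h4
  linear_combination α 1 ^ 4 * h0 - α 0 * α 1 ^ 3 * h1 + α 0 ^ 2 * α 1 ^ 2 * h2
    - α 0 ^ 3 * α 1 * h3 + α 0 ^ 4 * h4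

/-- Write `h = α m` and cancel `α` to get `m k = l β`. At the zero of `β`, either `k` vanishes or
`m` does; the latter would make `h` a multiple of `α β`. -/
theorem evalAtZero_eq_zero_of_formMulEq {α β : Fin 2 → ℂ} (hα : α ≠ 0) (hβ : β ≠ 0)
    {h k l : Fin 3 → ℂ} (hh : ∀ c : ℂ, h ≠ c • formMul α β)
    (H : FormMulEq h k l (formMul α β)) (h0 : evalAtZero α h = 0) : evalAtZero β k = 0 := by
  obtain ⟨m, rfl⟩ := (evalAtZero_eq_zero_iff hα h).1 h0
  obtain ⟨h0, h1, h2, h3, h4⟩ := H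
  simp [formMul] at h0 h1 h2 h3 h4
  have cancel : m 0 * k 0 = l 0 * β 0 ∧ m 0 * k 1 + m 1 * k 0 = l 0 * β 1 + l 1 * β 0 ∧
      m 0 * k 2 + m 1 * k 1 = l 1 * β 1 + l 2 * β 0 ∧ m 1 * k 2 = l 2 * β 1 := by
    -- Cancellation coefficient by coefficient: upwards from the constant term if `α 0 ≠ 0`,
    -- downwards from the top term if `α 1 ≠ 0`.
    rcases ne_zero_or_ne_zero hα with ha | ha
    · have c0 : m 0 * k 0 = l 0 * β 0 := mul_left_cancel₀ ha (by linear_combination h0)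
      have c1 : m 0 * k 1 + m 1 * k 0 = l 0 * β 1 + l 1 * β 0 :=
        mul_left_cancel₀ ha (by linear_combination h1 - α 1 * c0)
      have c2 : m 0 * k 2 + m 1 * k 1 = l 1 * β 1 + l 2 * β 0 :=
        mul_left_cancel₀ ha (by linear_combination h2 - α 1 * c1)
      exact ⟨c0, c1, c2, mul_left_cancel₀ ha (by linear_combination h3 - α 1 * c2)⟩
    · have c3 : m 1 * k 2 = l 2 * β 1 := mul_left_cancel₀ ha (by linear_combination h4)
      have c2 : m 0 * k 2 + m 1 * k 1 = l 1 * β 1 + l 2 * β 0 :=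
        mul_left_cancel₀ ha (by linear_combination h3 - α 0 * c3)
      have c1 : m 0 * k 1 + m 1 * k 0 = l 0 * β 1 + l 1 * β 0 :=
        mul_left_cancel₀ ha (by linear_combination h2 - α 0 * c2)
      exact ⟨mul_left_cancel₀ ha (by linear_combination h1 - α 0 * c1), c1, c2, c3⟩
  obtain ⟨c0, c1, c2, c3⟩ := cancel
  have : (β 1 * m 0 - β 0 * m 1) * evalAtZero β k = 0 := by
    simp only [evalAtZero]
    linear_combination β 1 ^ 3 * c0 - β 0 * β 1 ^ 2 * c1 + β 0 ^ 2 * β 1 * c2 - β 0 ^ 3 * c3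
  rcases mul_eq_zero.1 this with h | h
  · obtain ⟨c, rfl⟩ := exists_eq_smul_of_det_eq_zero hβ h
    exact absurd (formMul_smul_right c α β) (hh c)
  · exact h

theorem exists_formMulEq_iff {α β : Fin 2 → ℂ} (hα : α ≠ 0) (hβ : β ≠ 0)
    {h k : Fin 3 → ℂ} (hh : ∀ c : ℂ, h ≠ c • formMul α β) (hk : ∀ c : ℂ, k ≠ c • formMul α β) :
    (∃ l, FormMulEq h k l (formMul α β)) ↔
      (evalAtZero α h = 0 ∧ evalAtZero β k = 0) ∨ (evalAtZero β h = 0 ∧ evalAtZero α k = 0) := by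
  constructor
  · rintro ⟨l, H⟩
    rcases mul_eq_zero.1 (evalAtZero_mul_eq_zero H) with h0 | h0
    · exact Or.inl ⟨h0, evalAtZero_eq_zero_of_formMulEq hα hβ hh H h0⟩
    · refine Or.inr ⟨evalAtZero_eq_zero_of_formMulEq hα hβ (h := k) (k := h) (l := l) hk ?_ h0, h0⟩
      obtain ⟨h0, h1, h2, h3, h4⟩ := H
      exact ⟨by linear_combination h0, by linear_combination h1, by linear_combination h2,
        by linear_combination h3, by linear_combination h4⟩
  · rintro (⟨h1, h2⟩ | ⟨h1, h2⟩)
    · obtain ⟨m, rfl⟩ := (evalAtZero_eq_zero_iff hα h).1 h1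
      obtain ⟨n, rfl⟩ := (evalAtZero_eq_zero_iff hβ k).1 h2
      refine ⟨formMul m n, ?_, ?_, ?_, ?_, ?_⟩ <;> simp [formMul] <;> ring
    · obtain ⟨m, rfl⟩ := (evalAtZero_eq_zero_iff hβ h).1 h1
      obtain ⟨n, rfl⟩ := (evalAtZero_eq_zero_iff hα k).1 h2
      refine ⟨formMul m n, ?_, ?_, ?_, ?_, ?_⟩ <;> simp [formMul] <;> ring

/-! ### Tangent spaces and curves -/

theorem hasDerivAt_eval {n : ℕ} (F : MvPolynomial (Fin n) ℂ) {c : ℂ → Fin n → ℂ} {v : Fin n → ℂ}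
    {t : ℂ} (hc : HasDerivAt c v t) :
    HasDerivAt (fun s => MvPolynomial.eval (c s) F)
      (∑ i, MvPolynomial.eval (c t) (MvPolynomial.pderiv i F) * v i) t := by
  induction F using MvPolynomial.induction_on with
  | C r => simpa using hasDerivAt_const t r
  | add p q hp hq =>
    simp only [map_add, add_mul, Finset.sum_add_distrib]
    exact hp.add hq
  | mul_X p j hp =>
    have := hp.mul (hasDerivAt_pi.1 hc j)
    simp only [map_mul, MvPolynomial.eval_X]
    refine this.congr_deriv ?_
    simp only [Derivation.leibniz, MvPolynomial.pderiv_X, smul_eq_mul, map_add, map_mul,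
      MvPolynomial.eval_X, add_mul, Finset.sum_add_distrib]
    rw [add_comm]
    congr 1
    · simp [Pi.single_apply, apply_ite]
    · rw [Finset.sum_mul]
      exact Finset.sum_congr rfl fun i _ => by ring

/-- Every polynomial vanishing on the cone is constant along the curve. This produces tangent
vectors without knowing the full ideal of `X`. -/
theorem mem_embeddedTangentSpace_of_hasDerivAt {n : ℕ} {X : Set (ℙ ℂ (Fin n → ℂ))}
    {c : ℂ → Fin n → ℂ} {v : Fin n → ℂ} (hc : HasDerivAt c v 0)
    (hX : ∀ᶠ t in 𝓝 (0 : ℂ), c t ∈ affineCone X) : v ∈ embeddedTangentSpace X (c 0) := by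
  intro F hF
  have h0 : HasDerivAt (fun s => MvPolynomial.eval (c s) F) 0 0 :=
    (hasDerivAt_const (0 : ℂ) (0 : ℂ)).congr_of_eventuallyEq
      (hX.mono fun t ht => hF _ ht)
  exact (hasDerivAt_eval F hc).unique h0

theorem hasDerivAt_line {n : ℕ} (y v : Fin n → ℂ) :
    HasDerivAt (fun t : ℂ => y + t • v) v 0 := by
  simpa using ((hasDerivAt_id (0 : ℂ)).smul_const v).const_add y

theorem hasDerivAt_eval_line_of_mem {n : ℕ} {X : Set (ℙ ℂ (Fin n → ℂ))}
    {y v : Fin n → ℂ} (hv : v ∈ embeddedTangentSpace X y) {F : MvPolynomial (Fin n) ℂ}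
    (hF : ∀ x ∈ affineCone X, MvPolynomial.eval x F = 0) :
    HasDerivAt (fun t : ℂ => MvPolynomial.eval (y + t • v) F) 0 0 := by
  refine (hasDerivAt_eval F (hasDerivAt_line y v)).congr_deriv ?_
  simpa using hv F hF

theorem mem_affineCone_kummerSurface {a x : Fin 6 → ℂ} :
    x ∈ affineCone (kummerSurface a) ↔ ∀ j : Fin 3, ∑ i, a i ^ (j : ℕ) * x i ^ 2 = 0 := by
  rw [Fin.forall_fin_succ, Fin.forall_fin_two]
  by_cases hx : x = 0
  · simp [affineCone, hx]
  · obtain ⟨k, hk⟩ := Projectivization.exists_smul_eq_mk_rep ℂ x hx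
    have key : ∀ b : Fin 6 → ℂ, ∑ i, b i * (k • x) i ^ 2 = (k : ℂ) ^ 2 * ∑ i, b i * x i ^ 2 := by
      intro b
      rw [Finset.mul_sum]
      refine Finset.sum_congr rfl fun i _ => ?_
      simp only [Pi.smul_apply, Units.smul_def, smul_eq_mul]
      ring
    have k0 := key fun _ => 1
    simp only [one_mul] at k0
    have k1 := key a
    have k2 := key fun i => a i ^ 2
    simp only [affineCone, kummerSurface, Set.mem_ofPred_eq, ← hk, k0, k1, k2]
    simp [hx]

theorem affineCone_of_mk_mem {n : ℕ} {X : Set (ℙ ℂ (Fin n → ℂ))} {y : Fin n → ℂ} {hy : y ≠ 0}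
    (h : Projectivization.mk ℂ y hy ∈ X) : y ∈ affineCone X := fun _ => h

/-- The curve with coordinates `yᵢ √(1 + 2 t vᵢ / yᵢ)`. -/
def sqrtCurve (y v : Fin 6 → ℂ) (t : ℂ) (i : Fin 6) : ℂ :=
  y i * (1 + 2 * v i / y i * t) ^ (2⁻¹ : ℂ)

theorem sqrtCurve_zero (y v : Fin 6 → ℂ) : sqrtCurve y v 0 = y := by
  ext i; simp [sqrtCurve]

/-- The squares of the coordinates are affine in `t`, so the curve stays on diagonal quadrics
whenever its initial velocity is tangent to them. -/
theorem sqrtCurve_sq {y : Fin 6 → ℂ} (hy : ∀ i, y i ≠ 0) (v : Fin 6 → ℂ) (t : ℂ) (i : Fin 6) :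
    sqrtCurve y v t i ^ 2 = y i ^ 2 + 2 * t * (y i * v i) := by
  rw [sqrtCurve, mul_pow, Complex.cpow_ofNat_inv_pow]
  field_simp [hy i]

theorem analyticAt_sqrtCurve (y v : Fin 6 → ℂ) : AnalyticAt ℂ (sqrtCurve y v) 0 := by
  refine AnalyticAt.pi fun i => ?_
  refine analyticAt_const.mul (AnalyticAt.cpow ?_ analyticAt_const (by simp))
  fun_prop

theorem hasDerivAt_sqrtCurve {y : Fin 6 → ℂ} (hy : ∀ i, y i ≠ 0) (v : Fin 6 → ℂ) :
    HasDerivAt (sqrtCurve y v) v 0 := by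
  refine hasDerivAt_pi.2 fun i => ?_
  have h1 : HasDerivAt (fun t : ℂ => 1 + 2 * v i / y i * t) (2 * v i / y i) 0 := by
    simpa using ((hasDerivAt_id (0 : ℂ)).const_mul (2 * v i / y i)).const_add 1
  have h2 := (h1.cpow_const (c := 2⁻¹) (by simp)).const_mul (y i)
  refine h2.congr_deriv ?_
  simp
  field_simp [hy i]

theorem sqrtCurve_mem_affineCone {a y v : Fin 6 → ℂ} (hy : ∀ i, y i ≠ 0)
    (hyX : y ∈ affineCone (kummerSurface a))
    (hv : ∀ j : Fin 3, ∑ i, a i ^ (j : ℕ) * (y i * v i) = 0) (t : ℂ) :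
    sqrtCurve y v t ∈ affineCone (kummerSurface a) := by
  rw [mem_affineCone_kummerSurface] at hyX ⊢
  intro j
  have : ∑ i, a i ^ (j : ℕ) * sqrtCurve y v t i ^ 2 =
      ∑ i, a i ^ (j : ℕ) * y i ^ 2 + 2 * t * ∑ i, a i ^ (j : ℕ) * (y i * v i) := by
    rw [Finset.mul_sum, ← Finset.sum_add_distrib]
    exact Finset.sum_congr rfl fun i _ => by rw [sqrtCurve_sq hy]; ring
  rw [this, hyX j, hv j, mul_zero, add_zero]

/-- The three defining quadrics give the necessary conditions; conversely, a vector satisfying them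
is the velocity of `sqrtCurve`, so it is killed by every polynomial vanishing on the cone. -/
theorem mem_embeddedTangentSpace_kummerSurface {a y : Fin 6 → ℂ} (hy : ∀ i, y i ≠ 0)
    (hyX : y ∈ affineCone (kummerSurface a)) {v : Fin 6 → ℂ} :
    v ∈ embeddedTangentSpace (kummerSurface a) y ↔
      ∀ j : Fin 3, ∑ i, a i ^ (j : ℕ) * (y i * v i) = 0 := by
  constructor
  · intro hv j
    have h := hasDerivAt_eval_line_of_mem hv
      (F := ∑ i, MvPolynomial.C (a i ^ (j : ℕ)) * MvPolynomial.X i ^ 2)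
      (fun x hx => by simpa using mem_affineCone_kummerSurface.1 hx j)
    have h' : HasDerivAt (fun t : ℂ => ∑ i, a i ^ (j : ℕ) * (y i + t * v i) ^ 2)
        (∑ i, a i ^ (j : ℕ) * (2 * (y i * v i))) 0 := by
      refine HasDerivAt.fun_sum fun i _ => ?_
      have := (((hasDerivAt_pi.1 (hasDerivAt_line y v) i).pow 2).const_mul (a i ^ (j : ℕ)))
      refine this.congr_deriv ?_
      simp only [zero_smul, add_zero]
      push_cast
      ring
    have h2 := h'.unique (by simpa using h)
    have h3 : (2 : ℂ) * ∑ i, a i ^ (j : ℕ) * (y i * v i) = 0 := by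
      rw [← h2, Finset.mul_sum]
      exact Finset.sum_congr rfl fun i _ => by ring
    simpa using h3
  · intro hv
    have := mem_embeddedTangentSpace_of_hasDerivAt (hasDerivAt_sqrtCurve hy v)
      (.of_forall (sqrtCurve_mem_affineCone hy hyX hv))
    rwa [sqrtCurve_zero] at this

/-! ### The second fundamental form of the Kummer surface -/

theorem exists_lift_bilinear {U N : Type*} [AddCommGroup U] [Module ℂ U] [AddCommGroup N]
    [Module ℂ N] (p : Submodule ℂ U) (f : U →ₗ[ℂ] U →ₗ[ℂ] N)
    (hl : ∀ x ∈ p, ∀ w, f x w = 0) (hr : ∀ x ∈ p, ∀ v, f v x = 0) :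
    ∃ B : (U ⧸ p) →ₗ[ℂ] (U ⧸ p) →ₗ[ℂ] N, ∀ v w, B (p.mkQ v) (p.mkQ w) = f v w := by
  let g : (U ⧸ p) →ₗ[ℂ] U →ₗ[ℂ] N := p.liftQ f fun x hx => by
    ext w; exact hl x hx w
  have hg : ∀ v w, g (p.mkQ v) w = f v w := fun v w => rfl
  let B : (U ⧸ p) →ₗ[ℂ] (U ⧸ p) →ₗ[ℂ] N := p.liftQ g.flip fun x hx => by
    ext v
    exact (hg v x).trans (hr x hx v)
  refine ⟨B.flip, fun v w => ?_⟩
  exact hg v w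

/-- The coordinatewise product `-(vᵢ wᵢ / yᵢ)`. -/
def negMulDiv (y : Fin 6 → ℂ) : (Fin 6 → ℂ) →ₗ[ℂ] (Fin 6 → ℂ) →ₗ[ℂ] (Fin 6 → ℂ) :=
  LinearMap.mk₂ ℂ (fun v w i => -(v i * w i / y i))
    (fun _ _ _ => by ext i; simp; ring) (fun _ _ _ => by ext i; simp; ring)
    (fun _ _ _ => by ext i; simp; ring) (fun _ _ _ => by ext i; simp; ring)

theorem negMulDiv_apply (y v w : Fin 6 → ℂ) (i : Fin 6) :
    negMulDiv y v w i = -(v i * w i / y i) := rfl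

theorem isCurveThrough_sqrtCurve {a y : Fin 6 → ℂ} (hy : ∀ i, y i ≠ 0)
    (hyX : y ∈ affineCone (kummerSurface a))
    (v : embeddedTangentSpace (kummerSurface a) y) :
    IsCurveThrough (kummerSurface a) y v (sqrtCurve y v) :=
  ⟨analyticAt_sqrtCurve y v, .of_forall (sqrtCurve_mem_affineCone hy hyX
    ((mem_embeddedTangentSpace_kummerSurface hy hyX).1 v.2)), sqrtCurve_zero y v,
    (hasDerivAt_sqrtCurve hy v).deriv⟩

theorem eventually_mem_embeddedTangentSpace_iff {a y v : Fin 6 → ℂ} (hy : ∀ i, y i ≠ 0)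
    {c : ℂ → Fin 6 → ℂ} (hc : IsCurveThrough (kummerSurface a) y v c) :
    ∀ᶠ t in 𝓝 (0 : ℂ), (∀ i, c t i ≠ 0) ∧ ∀ w : Fin 6 → ℂ,
      w ∈ embeddedTangentSpace (kummerSurface a) (c t) ↔
        ∀ j : Fin 3, ∑ i, a i ^ (j : ℕ) * (c t i * w i) = 0 := by
  obtain ⟨han, hX, h0, -⟩ := hc
  have hne : ∀ᶠ t in 𝓝 (0 : ℂ), ∀ i, c t i ≠ 0 := by
    rw [Filter.eventually_all]
    intro i
    refine (continuousAt_pi.1 han.continuousAt i).eventually_ne ?_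
    rw [h0]
    exact hy i
  filter_upwards [hne, hX] with t h1 h2
  exact ⟨h1, fun w => mem_embeddedTangentSpace_kummerSurface h1 h2⟩

/-- Differentiating `∑ a i ^ j * (c i * s i) = 0` at `0` gives `∑ a i ^ j * (v i * w i + y i * s'(0)
i) = 0`, so `s'(0)` and `-(v i * w i / y i)` agree modulo the tangent space. -/
theorem isGrassmannVelocity_of_isCurveThrough {a y : Fin 6 → ℂ} (hy : ∀ i, y i ≠ 0)
    (hyX : y ∈ affineCone (kummerSurface a)) {v : Fin 6 → ℂ}
    {c : ℂ → Fin 6 → ℂ} (hc : IsCurveThrough (kummerSurface a) y v c)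
    {D : embeddedTangentSpace (kummerSurface a) y →ₗ[ℂ] NormalSpaceAt (kummerSurface a) y}
    (hD : ∀ w, D w = (embeddedTangentSpace (kummerSurface a) y).mkQ (negMulDiv y v w)) :
    IsGrassmannVelocity (fun t => embeddedTangentSpace (kummerSurface a) (c t))
      (embeddedTangentSpace (kummerSurface a) y) D := by
  have hev := eventually_mem_embeddedTangentSpace_iff hy hc
  obtain ⟨han, hX, h0, hv⟩ := hc
  have hder : ∀ i, HasDerivAt (fun t => c t i) (v i) 0 := by
    rw [← hasDerivAt_pi, ← hv]
    exact han.differentiableAt.hasDerivAt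
  refine ⟨congrArg _ h0, fun w => ?_, fun w s hs hs0 => ?_⟩
  -- This section keeps `c t i * s t i` equal to the constant `y i * w i`.
  · refine ⟨fun t i => y i * w.1 i / c t i, ⟨?_, ?_⟩, ?_⟩
    · refine AnalyticAt.pi fun i => ?_
      refine analyticAt_const.div (analyticAt_pi_iff.1 han i) ?_
      rw [h0]
      exact hy i
    · filter_upwards [hev] with t ht
      rw [ht.2]
      intro j
      rw [← (mem_embeddedTangentSpace_kummerSurface hy hyX).1 w.2 j]
      refine Finset.sum_congr rfl fun i _ => ?_
      field_simp [ht.1 i]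
    · ext i
      simp only [h0]
      field_simp [hy i]
  · rw [hD]
    have hsd : ∀ i, HasDerivAt (fun t => s t i) (deriv s 0 i) 0 :=
      hasDerivAt_pi.1 hs.1.differentiableAt.hasDerivAt
    rw [Submodule.mkQ_apply, Submodule.mkQ_apply, Submodule.Quotient.eq,
      mem_embeddedTangentSpace_kummerSurface hy hyX]
    intro j
    have h1 : HasDerivAt (fun t => ∑ i, a i ^ (j : ℕ) * (c t i * s t i))
        (∑ i, a i ^ (j : ℕ) * (v i * s 0 i + c 0 i * deriv s 0 i)) 0 :=
      HasDerivAt.fun_sum fun i _ => ((hder i).mul (hsd i)).const_mul _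
    have h2 : HasDerivAt (fun t => ∑ i, a i ^ (j : ℕ) * (c t i * s t i)) 0 0 := by
      refine (hasDerivAt_const (0 : ℂ) (0 : ℂ)).congr_of_eventuallyEq ?_
      filter_upwards [hev, hs.2] with t ht hst
      exact (ht.2 _).1 hst j
    have h3 := h1.unique h2
    rw [hs0, h0] at h3
    rw [← neg_eq_zero, ← Finset.sum_neg_distrib]
    refine Eq.trans ?_ h3
    refine Finset.sum_congr rfl fun i _ => ?_
    rw [Pi.sub_apply, negMulDiv_apply]
    field_simp [hy i]
    ring

theorem exists_isSecondFundamentalForm {a y : Fin 6 → ℂ} (hy : ∀ i, y i ≠ 0)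
    (hyX : y ∈ affineCone (kummerSurface a)) :
    ∃ II, IsSecondFundamentalForm (kummerSurface a) y II ∧
      ∀ v w : embeddedTangentSpace (kummerSurface a) y,
        II (toTangent _ y v) (toTangent _ y w) = 0 ↔
          ∀ j : Fin 3, ∑ i, a i ^ (j : ℕ) * (v.1 i * w.1 i) = 0 := by
  set U := embeddedTangentSpace (kummerSurface a) y with hU
  let f : U →ₗ[ℂ] U →ₗ[ℂ] NormalSpaceAt (kummerSurface a) y :=
    ((negMulDiv y).domRestrict₁₂ U U).compr₂ U.mkQ
  have hf : ∀ v w : U, f v w = U.mkQ (negMulDiv y v w) := fun v w => rfl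
  have hf0 : ∀ v w : U, f v w = 0 ↔ ∀ j : Fin 3, ∑ i, a i ^ (j : ℕ) * (v.1 i * w.1 i) = 0 := by
    intro v w
    rw [hf, Submodule.mkQ_apply, Submodule.Quotient.mk_eq_zero,
      mem_embeddedTangentSpace_kummerSurface hy hyX]
    refine forall_congr' fun j => ?_
    rw [← neg_eq_zero, ← Finset.sum_neg_distrib]
    refine Eq.congr (Finset.sum_congr rfl fun i _ => ?_) rfl
    rw [negMulDiv_apply]
    field_simp [hy i]
  have hsymm : ∀ v w : U, f v w = 0 → f w v = 0 := by
    intro v w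
    rw [hf0, hf0]
    simp only [mul_comm, imp_self]
  -- For `x = k • y` the vanishing condition is `k` times the tangency condition on `w`, so the form
  -- descends to the quotient by the line of `y`.
  have hl : ∀ x ∈ (Submodule.span ℂ {y}).submoduleOf U, ∀ w, f x w = 0 := by
    intro x hx w
    obtain ⟨k, hk⟩ := Submodule.mem_span_singleton.1 (Submodule.mem_comap.1 hx)
    rw [hf0]
    intro j
    have hk' : x.1 = k • y := hk.symm
    have := (mem_embeddedTangentSpace_kummerSurface hy hyX).1 w.2 j
    rw [hk', ← mul_zero k, ← this, Finset.mul_sum]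
    refine Finset.sum_congr rfl fun i _ => ?_
    rw [Pi.smul_apply, smul_eq_mul]
    ring
  obtain ⟨B, hB⟩ := exists_lift_bilinear _ f hl fun x hx v => hsymm _ _ (hl x hx v)
  refine ⟨B, ⟨fun v => ⟨_, isCurveThrough_sqrtCurve hy hyX v⟩, fun v c hc =>
    isGrassmannVelocity_of_isCurveThrough hy hyX hc fun w => hB v w⟩, fun v w => ?_⟩
  rw [← hf0, ← hB]

/-! ### The parametrization of the tangent plane -/

/-- The relation `yᵢ² f'(aᵢ) = g(aᵢ)` for nonzero `yᵢ` and distinct `aᵢ`. -/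
structure IsParametrized (a y : Fin 6 → ℂ) (g : Fin 3 → ℂ) : Prop where
  inj : Function.Injective a
  ne_zero : ∀ i, y i ≠ 0
  eq : ∀ i, y i ^ 2 * (nodePolynomial a).derivative.eval (a i) = quadEval g (a i)

section

variable {a y : Fin 6 → ℂ} {g : Fin 3 → ℂ}

theorem planeParam_apply (h : Fin 3 → ℂ) (i : Fin 6) :
    planeParam a y (g 0) (g 1) (g 2) h i = quadEval h (a i) * y i / quadEval g (a i) := rfl

theorem IsParametrized.quadEval_ne_zero (H : IsParametrized a y g) (i : Fin 6) :
    quadEval g (a i) ≠ 0 := by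
  rw [← H.eq]
  exact mul_ne_zero (pow_ne_zero 2 (H.ne_zero i)) (derivative_nodePolynomial_eval_ne_zero H.inj i)

theorem IsParametrized.coeff_ne_zero (H : IsParametrized a y g) : g ≠ 0 := by
  rintro rfl
  exact H.quadEval_ne_zero 0 (by simp [quadEval])

theorem IsParametrized.mem_affineCone (H : IsParametrized a y g) :
    y ∈ affineCone (kummerSurface a) :=
  mem_affineCone_kummerSurface.2
    ((sum_pow_mul_eq_zero_iff H.inj fun i => y i ^ 2).2 ⟨g, H.eq⟩)

theorem IsParametrized.planeParam_self (H : IsParametrized a y g) :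
    planeParam a y (g 0) (g 1) (g 2) g = y := by
  ext i
  rw [planeParam_apply, mul_div_cancel_left₀ _ (H.quadEval_ne_zero i)]

theorem IsParametrized.planeParam_injective (H : IsParametrized a y g) :
    Function.Injective (planeParam a y (g 0) (g 1) (g 2)) := by
  intro h k hk
  refine quadEval_injective H.inj fun i => ?_
  have := congrFun hk i
  rw [planeParam_apply, planeParam_apply, div_left_inj' (H.quadEval_ne_zero i)] at this
  exact mul_right_cancel₀ (H.ne_zero i) this

theorem IsParametrized.range_planeParam (H : IsParametrized a y g) :
    LinearMap.range (planeParam a y (g 0) (g 1) (g 2)) =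
      embeddedTangentSpace (kummerSurface a) y := by
  ext v
  rw [mem_embeddedTangentSpace_kummerSurface H.ne_zero H.mem_affineCone,
    sum_pow_mul_eq_zero_iff H.inj fun i => y i * v i, LinearMap.mem_range]
  refine exists_congr fun h => funext_iff.trans (forall_congr' fun i => ?_)
  have h0 := H.quadEval_ne_zero i
  rw [planeParam_apply, div_eq_iff h0, ← H.eq]
  constructor
  · intro e
    refine mul_right_cancel₀ (H.ne_zero i) ?_
    linear_combination -e
  · intro e
    linear_combination -y i * e

/-- By `y i ^ 2 * f'(a i) = g(a i)`, the product of the two vectors times `f'(a i)` is `h k / g` at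
`a i`; interpolation makes this a quadratic `l`. -/
theorem IsParametrized.sum_mul_planeParam_eq_zero_iff (H : IsParametrized a y g)
    (h k : Fin 3 → ℂ) :
    (∀ j : Fin 3, ∑ i, a i ^ (j : ℕ) * (planeParam a y (g 0) (g 1) (g 2) h i *
        planeParam a y (g 0) (g 1) (g 2) k i) = 0) ↔
      ∃ l, FormMulEq h k l g := by
  rw [sum_pow_mul_eq_zero_iff H.inj fun i => planeParam a y (g 0) (g 1) (g 2) h i *
    planeParam a y (g 0) (g 1) (g 2) k i]
  refine exists_congr fun l => ?_
  rw [← formMulEq_iff H.inj]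
  refine forall_congr' fun i => ?_
  have h0 := H.quadEval_ne_zero i
  have e : planeParam a y (g 0) (g 1) (g 2) h i * planeParam a y (g 0) (g 1) (g 2) k i *
      (nodePolynomial a).derivative.eval (a i) =
      quadEval h (a i) * quadEval k (a i) / quadEval g (a i) := by
    rw [planeParam_apply, planeParam_apply]
    field_simp
    rw [← H.eq]
    ring
  rw [e, div_eq_iff h0]

/-! ### Tangent lines -/

/-- Evaluation of binary quadratic forms at the zero of `α`, as a linear form. -/
def evalAtZeroLin (α : Fin 2 → ℂ) : (Fin 3 → ℂ) →ₗ[ℂ] ℂ where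
  toFun := evalAtZero α
  map_add' h k := by simp only [evalAtZero, Pi.add_apply]; ring
  map_smul' c h := by simp only [evalAtZero, Pi.smul_apply, smul_eq_mul, RingHom.id_apply]; ring

variable (a y g) in
/-- The line of the parametrized plane consisting of the multiples of the linear form `α`. -/
def lineOfForm (α : Fin 2 → ℂ) : Submodule ℂ (Fin 6 → ℂ) :=
  (LinearMap.ker (evalAtZeroLin α)).map (planeParam a y (g 0) (g 1) (g 2))

theorem mem_lineOfForm {α : Fin 2 → ℂ} {v : Fin 6 → ℂ} :
    v ∈ lineOfForm a y g α ↔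
      ∃ h, evalAtZero α h = 0 ∧ planeParam a y (g 0) (g 1) (g 2) h = v := Iff.rfl

theorem lineOfForm_smul {c : ℂ} (hc : c ≠ 0) (α : Fin 2 → ℂ) :
    lineOfForm a y g (c • α) = lineOfForm a y g α := by
  have : ∀ h, evalAtZero (c • α) h = c ^ 2 * evalAtZero α h := by
    intro h
    simp only [evalAtZero, Pi.smul_apply, smul_eq_mul]
    ring
  ext v
  simp [mem_lineOfForm, this, hc]

theorem IsParametrized.mem_lineOfForm_planeParam (H : IsParametrized a y g) {α : Fin 2 → ℂ}
    {h : Fin 3 → ℂ} :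
    planeParam a y (g 0) (g 1) (g 2) h ∈ lineOfForm a y g α ↔ evalAtZero α h = 0 := by
  rw [mem_lineOfForm]
  constructor
  · rintro ⟨k, hk, e⟩
    rwa [← H.planeParam_injective e]
  · intro h0
    exact ⟨h, h0, rfl⟩

theorem mem_tangentLine {n : ℕ} {X : Set (ℙ ℂ (Fin n → ℂ))} {y : Fin n → ℂ}
    {d : ℙ ℂ (TangentSpaceAt X y)} {u : embeddedTangentSpace X y}
    (hu : toTangent X y u = d.rep) {v : Fin n → ℂ} :
    v ∈ tangentLine X y d → ∃ b c : ℂ, v = b • (u : Fin n → ℂ) + c • y := by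
  rintro ⟨w, hw, rfl⟩
  rw [SetLike.mem_coe, Submodule.mem_comap, Projectivization.submodule_eq,
    Submodule.mem_span_singleton] at hw
  obtain ⟨b, hb⟩ := hw
  rw [← hu, ← map_smul, eq_comm, ← sub_eq_zero, ← map_sub, Submodule.mkQ_apply,
    Submodule.Quotient.mk_eq_zero] at hb
  obtain ⟨c, hc⟩ := Submodule.mem_span_singleton.1 (Submodule.mem_comap.1 hb)
  refine ⟨b, c, ?_⟩
  rw [hc]
  simp

theorem mem_tangentLine_of_rep {n : ℕ} {X : Set (ℙ ℂ (Fin n → ℂ))} {y : Fin n → ℂ}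
    {d : ℙ ℂ (TangentSpaceAt X y)} {u : embeddedTangentSpace X y}
    (hu : toTangent X y u = d.rep) : (u : Fin n → ℂ) ∈ tangentLine X y d := by
  refine ⟨u, ?_, rfl⟩
  rw [SetLike.mem_coe, Submodule.mem_comap, Projectivization.submodule_eq, hu]
  exact Submodule.mem_span_singleton_self _

theorem mem_tangentLine_self {n : ℕ} {X : Set (ℙ ℂ (Fin n → ℂ))} {y : Fin n → ℂ}
    (hy : y ∈ embeddedTangentSpace X y) (d : ℙ ℂ (TangentSpaceAt X y)) :
    y ∈ tangentLine X y d := by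
  refine ⟨⟨y, hy⟩, ?_, rfl⟩
  have : toTangent X y ⟨y, hy⟩ = 0 := by
    rw [Submodule.mkQ_apply, Submodule.Quotient.mk_eq_zero]
    exact Submodule.mem_span_singleton_self y
  rw [SetLike.mem_coe, Submodule.mem_comap, this]
  exact zero_mem _

theorem toTangent_eq_zero_iff {n : ℕ} {X : Set (ℙ ℂ (Fin n → ℂ))} {y : Fin n → ℂ}
    (u : embeddedTangentSpace X y) :
    toTangent X y u = 0 ↔ ∃ c : ℂ, c • y = (u : Fin n → ℂ) := by
  rw [Submodule.mkQ_apply, Submodule.Quotient.mk_eq_zero]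
  exact Submodule.mem_span_singleton

theorem IsParametrized.planeParam_mem (H : IsParametrized a y g) (h : Fin 3 → ℂ) :
    planeParam a y (g 0) (g 1) (g 2) h ∈ embeddedTangentSpace (kummerSurface a) y :=
  H.range_planeParam ▸ LinearMap.mem_range_self _ h

theorem IsParametrized.self_mem (H : IsParametrized a y g) :
    y ∈ embeddedTangentSpace (kummerSurface a) y := by
  have := H.planeParam_mem g
  rwa [H.planeParam_self] at this

theorem IsParametrized.toTangent_eq_zero_iff (H : IsParametrized a y g) (h : Fin 3 → ℂ) :
    toTangent (kummerSurface a) y ⟨_, H.planeParam_mem h⟩ = 0 ↔ ∃ c : ℂ, h = c • g := by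
  rw [KummerConj.toTangent_eq_zero_iff]
  refine exists_congr fun c => ?_
  rw [← H.planeParam_injective.eq_iff, map_smul, H.planeParam_self, eq_comm]

theorem IsParametrized.exists_rep (H : IsParametrized a y g)
    (d : ℙ ℂ (TangentSpaceAt (kummerSurface a) y)) :
    ∃ h, toTangent (kummerSurface a) y ⟨_, H.planeParam_mem h⟩ = d.rep ∧
      ∀ c : ℂ, h ≠ c • g := by
  obtain ⟨⟨v, hv⟩, hd⟩ := Submodule.mkQ_surjective _ d.rep
  obtain ⟨h, rfl⟩ := H.range_planeParam.symm ▸ hv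
  refine ⟨h, hd, fun c hc => d.rep_nonzero ?_⟩
  rw [← hd]
  exact (H.toTangent_eq_zero_iff h).2 ⟨c, hc⟩

theorem exists_eq_add_of_evalAtZero {α β : Fin 2 → ℂ} (hα : α ≠ 0) (hβ : β ≠ 0)
    {h k : Fin 3 → ℂ} (hh : ∀ c : ℂ, h ≠ c • formMul α β) (h0 : evalAtZero α h = 0)
    (k0 : evalAtZero α k = 0) : ∃ b c : ℂ, k = b • h + c • formMul α β := by
  obtain ⟨m, rfl⟩ := (evalAtZero_eq_zero_iff hα h).1 h0
  obtain ⟨n, rfl⟩ := (evalAtZero_eq_zero_iff hα k).1 k0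
  have hD : β 1 * m 0 - β 0 * m 1 ≠ 0 := by
    intro hD
    obtain ⟨c, rfl⟩ := exists_eq_smul_of_det_eq_zero hβ hD
    exact hh c (formMul_smul_right c α β)
  -- Cramer's rule for `n = b • m + c • β`, then multiplied by `α`.
  refine ⟨(β 1 * n 0 - β 0 * n 1) / (β 1 * m 0 - β 0 * m 1),
    (n 1 * m 0 - n 0 * m 1) / (β 1 * m 0 - β 0 * m 1), ?_⟩
  ext j
  fin_cases j <;> simp [formMul] <;> field_simp <;> ring

theorem IsParametrized.tangentLine_eq_iff {α β : Fin 2 → ℂ}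
    (H : IsParametrized a y g) (hg : g = formMul α β) (hα : α ≠ 0) (hβ : β ≠ 0)
    {d : ℙ ℂ (TangentSpaceAt (kummerSurface a) y)} {h : Fin 3 → ℂ}
    (hd : toTangent (kummerSurface a) y ⟨_, H.planeParam_mem h⟩ = d.rep)
    (hh : ∀ c : ℂ, h ≠ c • g) :
    tangentLine (kummerSurface a) y d = lineOfForm a y g α ↔
      evalAtZero α h = 0 := by
  subst hg
  have hg : evalAtZero α (formMul α β) = 0 := (evalAtZero_eq_zero_iff hα _).2 ⟨β, rfl⟩
  constructor
  · intro e
    have := mem_tangentLine_of_rep hd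
    rwa [e, H.mem_lineOfForm_planeParam] at this
  · intro h0
    apply le_antisymm
    · intro v hv
      obtain ⟨b, c, rfl⟩ := mem_tangentLine hd hv
      refine add_mem (Submodule.smul_mem _ _ (H.mem_lineOfForm_planeParam.2 h0))
        (Submodule.smul_mem _ _ ?_)
      rw [← H.mem_lineOfForm_planeParam, H.planeParam_self] at hg
      exact hg
    · rintro _ ⟨k, hk, rfl⟩
      obtain ⟨b, c, rfl⟩ := exists_eq_add_of_evalAtZero hα hβ hh h0 hk
      rw [map_add, map_smul, map_smul, H.planeParam_self]
      refine add_mem (Submodule.smul_mem _ _ (mem_tangentLine_of_rep hd))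
        (Submodule.smul_mem _ _ (mem_tangentLine_self ?_ d))
      exact H.self_mem

theorem formMul_right_injective {α : Fin 2 → ℂ} (hα : α ≠ 0) :
    Function.Injective (formMul α) := by
  intro β γ e
  have e0 : α 0 * β 0 = α 0 * γ 0 := congrFun e 0
  have e1 : α 0 * β 1 + α 1 * β 0 = α 0 * γ 1 + α 1 * γ 0 := congrFun e 1
  have e2 : α 1 * β 1 = α 1 * γ 1 := congrFun e 2
  rcases ne_zero_or_ne_zero hα with h | h
  · have h0 := mul_left_cancel₀ h e0
    have h1 : β 1 = γ 1 := mul_left_cancel₀ h (by linear_combination e1 - α 1 * h0)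
    ext j; fin_cases j <;> assumption
  · have h1 := mul_left_cancel₀ h e2
    have h0 : β 0 = γ 0 := mul_left_cancel₀ h (by linear_combination e1 - α 0 * h1)
    ext j; fin_cases j <;> assumption

/-- Take `m` not proportional to `β`: then `α m` is not a multiple of `g = α β`, so it represents a
direction. This shows that each tangent line through `y` is actually attained. -/
theorem IsParametrized.exists_tangentLine_eq {α β : Fin 2 → ℂ}
    (H : IsParametrized a y (formMul α β)) (hα : α ≠ 0) (hβ : β ≠ 0) :
    ∃ d, tangentLine (kummerSurface a) y d = lineOfForm a y (formMul α β) α := by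
  obtain ⟨m, hm⟩ := exists_det_ne_zero hβ
  have hne : toTangent (kummerSurface a) y ⟨_, H.planeParam_mem (formMul α m)⟩ ≠ 0 := by
    rw [Ne, H.toTangent_eq_zero_iff]
    rintro ⟨c, hc⟩
    rw [← formMul_smul_right] at hc
    obtain rfl := formMul_right_injective hα hc
    refine hm ?_
    simp only [Pi.smul_apply, smul_eq_mul]
    ring
  -- The chosen representative of the direction differs from this vector by a unit `k`, which is
  -- absorbed into `m`.
  obtain ⟨k, hk⟩ := Projectivization.exists_smul_eq_mk_rep ℂ _ hne
  have hd : toTangent (kummerSurface a) y ⟨_, H.planeParam_mem (formMul α ((k : ℂ) • m))⟩ =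
      (Projectivization.mk ℂ _ hne).rep := by
    rw [← hk, Units.smul_def, ← map_smul]
    congr 1
    ext1
    exact (congrArg _ (formMul_smul_right _ _ _)).trans (map_smul _ _ _)
  refine ⟨_, (H.tangentLine_eq_iff rfl hα hβ hd fun c hc => ?_).2
    ((evalAtZero_eq_zero_iff hα _).2 ⟨_, rfl⟩)⟩
  exact Projectivization.rep_nonzero _ (hd ▸ (H.toTangent_eq_zero_iff _).2 ⟨c, hc⟩)

/-! ### The tangent lines of the conic -/

/-- A linear form on `ℂⁿ` as a polynomial. -/
def linearPolynomial {n : ℕ} (φ : (Fin n → ℂ) →ₗ[ℂ] ℂ) : MvPolynomial (Fin n) ℂ :=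
  ∑ i, MvPolynomial.C (φ (Pi.single i 1)) * MvPolynomial.X i

theorem eval_linearPolynomial {n : ℕ} (φ : (Fin n → ℂ) →ₗ[ℂ] ℂ) (x : Fin n → ℂ) :
    MvPolynomial.eval x (linearPolynomial φ) = φ x := by
  rw [LinearMap.pi_apply_eq_sum_univ φ x]
  simp only [linearPolynomial, map_sum, map_mul, MvPolynomial.eval_C, MvPolynomial.eval_X,
    smul_eq_mul]
  refine Finset.sum_congr rfl fun i _ => ?_
  rw [mul_comm]
  congr 2
  ext j
  simp [Pi.single_apply, eq_comm]

/-- Linear forms vanishing on `W` are polynomials vanishing on the cone, and they cut out `W`. -/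
theorem embeddedTangentSpace_le {n : ℕ} {X : Set (ℙ ℂ (Fin n → ℂ))} {W : Submodule ℂ (Fin n → ℂ)}
    (h : ∀ x ∈ affineCone X, x ∈ W) (y : Fin n → ℂ) : embeddedTangentSpace X y ≤ W := by
  intro v hv
  by_contra hvW
  obtain ⟨φ, hφv, hφ⟩ := Submodule.exists_le_ker_of_notMem hvW
  have h0 := hasDerivAt_eval_line_of_mem hv (F := linearPolynomial φ)
    (fun x hx => by rw [eval_linearPolynomial]; exact hφ (h x hx))
  have h1 : HasDerivAt (fun t : ℂ => φ y + t * φ v) (φ v) 0 := by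
    simpa using ((hasDerivAt_id (0 : ℂ)).mul_const (φ v)).const_add (φ y)
  refine hφv (h1.unique ?_)
  simpa [eval_linearPolynomial] using h0

theorem mem_affineCone_conicGamma {x : Fin 6 → ℂ} :
    x ∈ affineCone (conicGamma a y (g 0) (g 1) (g 2)) ↔
      ∃ m, planeParam a y (g 0) (g 1) (g 2) (formMul m m) = x := by
  constructor
  · intro hx
    by_cases hx0 : x = 0
    · exact ⟨0, by rw [formMul_zero_left, map_zero, hx0]⟩
    · obtain ⟨p, q, r, e, hd⟩ := hx hx0
      obtain ⟨k, hk⟩ := Projectivization.exists_smul_eq_mk_rep ℂ x hx0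
      obtain ⟨m, hm⟩ := exists_eq_formMul_self (h := (k : ℂ)⁻¹ • ![p, q, r]) (by
        simp
        linear_combination (k : ℂ)⁻¹ ^ 2 * hd)
      refine ⟨m, ?_⟩
      rw [← hm, map_smul, ← e, ← hk, Units.smul_def, inv_smul_smul₀ k.ne_zero]
  · rintro ⟨m, rfl⟩ hx0
    obtain ⟨k, hk⟩ := Projectivization.exists_smul_eq_mk_rep ℂ _ hx0
    refine ⟨k * (m 0 * m 0), k * (m 0 * m 1 + m 1 * m 0), k * (m 1 * m 1), ?_, by ring⟩
    rw [← hk, Units.smul_def, ← map_smul]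
    congr 1
    ext j
    fin_cases j <;> rfl

/-- The differential of `q² - 4rp` at `m²` is `-4` times evaluation at the zero of `m`, which bounds
the tangent space; conversely, curves of squares through `m²` attain every velocity `m l`. -/
theorem IsParametrized.embeddedTangentSpace_conicGamma (H : IsParametrized a y g)
    {m : Fin 2 → ℂ} (hm : m ≠ 0) :
    embeddedTangentSpace (conicGamma a y (g 0) (g 1) (g 2))
      (planeParam a y (g 0) (g 1) (g 2) (formMul m m)) = lineOfForm a y g m := by
  set P := planeParam a y (g 0) (g 1) (g 2) with hP
  apply le_antisymm
  · intro v hv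
    obtain ⟨k, rfl⟩ : v ∈ LinearMap.range P := by
      refine embeddedTangentSpace_le (fun x hx => ?_) _ hv
      obtain ⟨m, rfl⟩ := mem_affineCone_conicGamma.1 hx
      exact LinearMap.mem_range_self _ _
    -- A left inverse turns the plane coordinates `p, q, r` into linear polynomials on `ℂ⁶`, so the
    -- conic's equation can be tested as an ambient polynomial.
    obtain ⟨G, hG⟩ := P.exists_leftInverse_of_injective
      (LinearMap.ker_eq_bot.2 H.planeParam_injective)
    have hG' : ∀ h, G (P h) = h := fun h => LinearMap.congr_fun hG h
    let φ : Fin 3 → MvPolynomial (Fin 6) ℂ := fun j => linearPolynomial (LinearMap.proj j ∘ₗ G)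
    have hφ : ∀ j h, MvPolynomial.eval (P h) (φ j) = h j := fun j h => by
      simp [φ, eval_linearPolynomial, hG']
    have h0 := hasDerivAt_eval_line_of_mem hv
      (F := φ 1 ^ 2 - MvPolynomial.C 4 * φ 2 * φ 0) (fun x hx => by
        obtain ⟨m, rfl⟩ := mem_affineCone_conicGamma.1 hx
        simp [← hP, hφ, formMul]
        ring)
    have hd : ∀ j, HasDerivAt (fun t : ℂ => formMul m m j + t * k j) (k j) 0 := fun j => by
      simpa using ((hasDerivAt_id (0 : ℂ)).mul_const (k j)).const_add (formMul m m j)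
    have h1 := ((hd 1).pow 2).sub (((hd 2).const_mul 4).mul (hd 0))
    simp only [← map_smul, ← map_add, map_sub, map_mul, map_pow, MvPolynomial.eval_C, hφ] at h0
    have h2 := h1.unique h0
    refine H.mem_lineOfForm_planeParam.2 ?_
    simp [formMul] at h2
    simp only [evalAtZero]
    linear_combination (-1 / 4 : ℂ) * h2
  · rintro _ ⟨k, hk, rfl⟩
    obtain ⟨l, rfl⟩ := (evalAtZero_eq_zero_iff hm k).1 hk
    -- Expansion of `(m + (t / 2) l)²`; the factor `1 / 2` makes the velocity exactly `m l`.
    have e : ∀ t : ℂ, P (formMul (m + (t / 2) • l) (m + (t / 2) • l)) =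
        P (formMul m m) + t • P (formMul m l) + (t ^ 2 / 4) • P (formMul l l) := by
      intro t
      rw [← map_smul, ← map_smul, ← map_add, ← map_add]
      congr 1
      ext j
      fin_cases j <;> simp [formMul] <;> ring
    have hc : HasDerivAt (fun t : ℂ => P (formMul (m + (t / 2) • l) (m + (t / 2) • l)))
        (P (formMul m l)) 0 := by
      simp only [e]
      have h1 := (((hasDerivAt_id (0 : ℂ)).pow 2).div_const 4).smul_const (P (formMul l l))
      refine ((hasDerivAt_line (P (formMul m m)) (P (formMul m l))).add h1).congr_deriv ?_
      simp
    have := mem_embeddedTangentSpace_of_hasDerivAt hc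
      (.of_forall fun t => mem_affineCone_conicGamma.2 ⟨_, rfl⟩)
    simpa using this

theorem IsParametrized.tangentLinesThrough_conicGamma {α β : Fin 2 → ℂ}
    (H : IsParametrized a y (formMul α β)) (hα : α ≠ 0) (hβ : β ≠ 0) :
    tangentLinesThrough (conicGamma a y (formMul α β 0) (formMul α β 1) (formMul α β 2)) y =
      {lineOfForm a y (formMul α β) α, lineOfForm a y (formMul α β) β} := by
  have hmem : ∀ m, y ∈ lineOfForm a y (formMul α β) m ↔ evalAtZero m (formMul α β) = 0 := by
    intro m
    rw [← H.mem_lineOfForm_planeParam, H.planeParam_self]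
  have hex : ∀ m, m ≠ 0 → evalAtZero m (formMul α β) = 0 →
      lineOfForm a y (formMul α β) m ∈
        tangentLinesThrough (conicGamma a y (formMul α β 0) (formMul α β 1) (formMul α β 2)) y := by
    intro m hm h0
    set P := planeParam a y (formMul α β 0) (formMul α β 1) (formMul α β 2) with hP
    have hne : P (formMul m m) ≠ 0 := by
      rw [Ne, map_eq_zero_iff _ H.planeParam_injective, formMul_comm]
      intro h
      refine hm (formMul_right_injective hm (h.trans ?_))
      rw [formMul_comm, formMul_zero_left]
    obtain ⟨k, hk⟩ := Projectivization.exists_smul_eq_mk_rep ℂ _ hne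
    -- The representative of the point is `k m² = (s m)²`, again the image of a square.
    obtain ⟨s, hs⟩ := IsAlgClosed.exists_pow_nat_eq (k : ℂ) (n := 2) (by norm_num)
    have hs0 : s ≠ 0 := by
      rintro rfl
      exact k.ne_zero (by simpa using hs.symm)
    refine ⟨Projectivization.mk ℂ _ hne, mem_affineCone_conicGamma.2 ⟨m, rfl⟩ hne, ?_,
      (hmem m).2 h0⟩
    have e : (Projectivization.mk ℂ _ hne).rep = P (formMul (s • m) (s • m)) := by
      rw [← hk, formMul_smul_right, formMul_comm (s • m), formMul_smul_right, smul_smul, ← sq, hs,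
        map_smul, Units.smul_def]
    rw [e, H.embeddedTangentSpace_conicGamma (smul_ne_zero hs0 hm), lineOfForm_smul hs0]
  ext L
  constructor
  · rintro ⟨u, hu, rfl, hy⟩
    obtain ⟨m, hm⟩ := (mem_affineCone_conicGamma (x := u.rep)).1
      (fun _ => by rwa [u.mk_rep])
    have hm0 : m ≠ 0 := by
      rintro rfl
      rw [formMul_zero_left, map_zero] at hm
      exact u.rep_nonzero hm.symm
    rw [← hm, H.embeddedTangentSpace_conicGamma hm0] at hy ⊢
    rw [hmem, evalAtZero_formMul, mul_eq_zero] at hy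
    have smul_eq : ∀ γ : Fin 2 → ℂ, γ ≠ 0 → m 1 * γ 0 - m 0 * γ 1 = 0 →
        lineOfForm a y (formMul α β) m = lineOfForm a y (formMul α β) γ := by
      intro γ hγ h
      obtain ⟨c, rfl⟩ := exists_eq_smul_of_det_eq_zero hm0 h
      exact (lineOfForm_smul (left_ne_zero_of_smul hγ) m).symm
    exact hy.imp (smul_eq α hα) (smul_eq β hβ)
  · rintro (rfl | rfl)
    · exact hex α hα ((evalAtZero_eq_zero_iff hα _).2 ⟨β, rfl⟩)
    · exact hex β hβ ((evalAtZero_eq_zero_iff hβ _).2 ⟨α, formMul_comm α β⟩)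

/-! ### Conjugate directions and the two factors of `g` -/

theorem IsParametrized.areConjugate_iff {α β : Fin 2 → ℂ}
    (H : IsParametrized a y (formMul α β)) (hα : α ≠ 0) (hβ : β ≠ 0)
    {II : TangentSpaceAt (kummerSurface a) y →ₗ[ℂ] TangentSpaceAt (kummerSurface a) y →ₗ[ℂ]
      NormalSpaceAt (kummerSurface a) y}
    (hII : ∀ v w : embeddedTangentSpace (kummerSurface a) y,
        II (toTangent _ y v) (toTangent _ y w) = 0 ↔
          ∀ j : Fin 3, ∑ i, a i ^ (j : ℕ) * (v.1 i * w.1 i) = 0)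
    (d d' : ℙ ℂ (TangentSpaceAt (kummerSurface a) y)) :
    AreConjugate II d d' ↔
      ({tangentLine (kummerSurface a) y d, tangentLine (kummerSurface a) y d'} : Set _) =
        {lineOfForm a y (formMul α β) α, lineOfForm a y (formMul α β) β} := by
  obtain ⟨h, hd, hh⟩ := H.exists_rep d
  obtain ⟨k, hd', hk⟩ := H.exists_rep d'
  rw [Set.pair_eq_pair_iff, H.tangentLine_eq_iff rfl hα hβ hd hh,
    H.tangentLine_eq_iff rfl hα hβ hd' hk, H.tangentLine_eq_iff (formMul_comm α β) hβ hα hd hh,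
    H.tangentLine_eq_iff (formMul_comm α β) hβ hα hd' hk, ← exists_formMulEq_iff hα hβ hh hk,
    ← H.sum_mul_planeParam_eq_zero_iff, AreConjugate, ← hd, ← hd', hII]

end

end KummerConj

end

theorem mainTheorem2 (a : Fin 6 → ℂ) (ha : Function.Injective a)
    (y : Fin 6 → ℂ) (hy0 : y ≠ 0)
    (hyX : Projectivization.mk ℂ y hy0 ∈ KummerConj.kummerSurface a)
    (hface : ∀ i, y i ≠ 0) (ξ η ζ : ℂ)
    (hcoord : ∀ i, y i ^ 2 * (KummerConj.nodePolynomial a).derivative.eval (a i)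
      = ξ + η * a i + ζ * a i ^ 2) :
    (Function.Injective (KummerConj.planeParam a y ξ η ζ) ∧
      LinearMap.range (KummerConj.planeParam a y ξ η ζ)
        = KummerConj.embeddedTangentSpace (KummerConj.kummerSurface a) y) ∧
    ∃ II, KummerConj.IsSecondFundamentalForm (KummerConj.kummerSurface a) y II ∧
      {L | ∃ d d', KummerConj.AreConjugate II d d' ∧
          L = KummerConj.tangentLine (KummerConj.kummerSurface a) y d}
        = KummerConj.tangentLinesThrough (KummerConj.conicGamma a y ξ η ζ) y ∧
      ∀ d d', KummerConj.AreConjugate II d d' ↔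
        {KummerConj.tangentLine (KummerConj.kummerSurface a) y d,
          KummerConj.tangentLine (KummerConj.kummerSurface a) y d'}
          = KummerConj.tangentLinesThrough (KummerConj.conicGamma a y ξ η ζ) y := by
  obtain ⟨α, β, hg⟩ := KummerConj.exists_eq_formMul ![ξ, η, ζ]
  have H : KummerConj.IsParametrized a y (KummerConj.formMul α β) :=
    ⟨ha, hface, fun i => (hcoord i).trans (by rw [← hg]; rfl)⟩
  obtain rfl : KummerConj.formMul α β 0 = ξ := congrFun hg.symm 0
  obtain rfl : KummerConj.formMul α β 1 = η := congrFun hg.symm 1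
  obtain rfl : KummerConj.formMul α β 2 = ζ := congrFun hg.symm 2
  have hα : α ≠ 0 := by
    rintro rfl
    exact H.coeff_ne_zero (KummerConj.formMul_zero_left β)
  have hβ : β ≠ 0 := by
    rintro rfl
    exact H.coeff_ne_zero ((KummerConj.formMul_comm α 0).trans (KummerConj.formMul_zero_left α))
  obtain ⟨II, hII, hII0⟩ := KummerConj.exists_isSecondFundamentalForm hface
    (KummerConj.affineCone_of_mk_mem hyX)
  have hconj := H.areConjugate_iff hα hβ hII0
  refine ⟨⟨H.planeParam_injective, H.range_planeParam⟩, II, hII, ?_, ?_⟩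
  · obtain ⟨d₁, h₁⟩ := H.exists_tangentLine_eq hα hβ
    obtain ⟨d₂, h₂⟩ : ∃ d, KummerConj.tangentLine (KummerConj.kummerSurface a) y d =
        KummerConj.lineOfForm a y (KummerConj.formMul α β) β := by
      -- The second line follows from the first by exchanging the factors `α` and `β`.
      rw [KummerConj.formMul_comm] at H ⊢
      exact H.exists_tangentLine_eq hβ hα
    rw [H.tangentLinesThrough_conicGamma hα hβ]
    ext L
    constructor
    · rintro ⟨d, d', hdd, rfl⟩
      rw [← (hconj d d').1 hdd]
      exact Set.mem_insert _ _
    · rintro (rfl | rfl)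
      · exact ⟨d₁, d₂, (hconj d₁ d₂).2 (by rw [h₁, h₂]), h₁.symm⟩
      · exact ⟨d₂, d₁, (hconj d₂ d₁).2 (by rw [h₁, h₂, Set.pair_comm]), h₂.symm⟩
  · rw [H.tangentLinesThrough_conicGamma hα hβ]
    exact hconj
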